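/- Let $A$ and $B$ be unital complex Banach algebras, and let $\phi\colon A\to B$ be a continuous unital algebra homomorphism which is dense (that is, $\phi(A)$ is dense in $B$) and spectral (that is, $\mathrm{sp}_B(\phi(a))=\mathrm{sp}_A(a)$ for all $a\in A$). For a unital Banach algebra $R$ and $n\ge 1$, let $\mathrm{Lg}_n(R)=\{(r_1,\dots,r_n)\in R^n : Rr_1+\dots+Rr_n=R\}$ be the space of unimodular $n$-tuples, with the topology of a subspace of $R^n$. The group $\mathrm{GL}_n(R)$ of invertible $n\times n$ matrices over $R$ acts on $\mathrm{Lg}_n(R)$ by left multiplication of columns; let $\mathrm{GL}_n^0(R)$ be the identity component of $\mathrm{GL}_n(R)$. The connected stable rank $\mathrm{csr}\,R$ (respectively the general stable rank $\mathrm{gsr}\,R$) is the least integer $n\ge 1$ such that $\mathrm{GL}_m^0(R)$ (respectively $\mathrm{GL}_m(R)$) acts transitively on $\mathrm{Lg}_m(R)$ for all $m\ge n$, and it is $\infty$ if there is no such $n$. For a space $X$, let $[X]$ be its set of path components. Then $$\mathrm{csr}\,A=\mathrm{csr}\,B\qquad\text{and}\qquad \mathrm{gsr}\,A=\mathrm{gsr}\,B.$$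 Moreover, for every $n\ge 1$, the map $[\mathrm{Lg}_n(A)]\to[\mathrm{Lg}_n(B)]$ induced by applying $\phi$ to each entry is a bijection. -/

import Mathlib

namespace StableRank

/-- `Lg A n`: the unimodular `n`-tuples of `A`, that is, the tuples `(a₁, …, aₙ)` with
`A a₁ + ⋯ + A aₙ = A`. (For a noncommutative ring, `Ideal.span` is the generated left ideal.) -/
def Lg (A : Type*) [Ring A] (n : ℕ) : Set (Fin n → A) :=
  {a | Ideal.span (Set.range a) = ⊤}

section Unimodular

variable {A : Type*} [Ring A] {n : ℕ}

theorem mem_Lg_iff {a : Fin n → A} : a ∈ Lg A n ↔ ∃ c : Fin n → A, ∑ i, c i * a i = 1 := by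
  change Ideal.span (Set.range a) = ⊤ ↔ _
  rw [Ideal.eq_top_iff_one]
  exact Submodule.mem_span_range_iff_exists_fun A

theorem mulVec_mem_Lg (g : (Matrix (Fin n) (Fin n) A)ˣ) {a : Fin n → A} (ha : a ∈ Lg A n) :
    (g : Matrix (Fin n) (Fin n) A).mulVec a ∈ Lg A n := by
  rw [mem_Lg_iff] at ha ⊢
  obtain ⟨c, hc⟩ := ha
  refine ⟨Matrix.vecMul c (↑g⁻¹ : Matrix (Fin n) (Fin n) A), ?_⟩
  change dotProduct (Matrix.vecMul c (↑g⁻¹ : Matrix (Fin n) (Fin n) A))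
    ((g : Matrix (Fin n) (Fin n) A).mulVec a) = 1
  rw [Matrix.dotProduct_mulVec, Matrix.vecMul_vecMul, Units.inv_mul, Matrix.vecMul_one]
  exact hc

/-- The action of `GL_n(A)` on `Lg_n(A)` by left multiplication of columns. -/
instance instMulActionLg : MulAction (Matrix (Fin n) (Fin n) A)ˣ (Lg A n) where
  smul g a := ⟨(g : Matrix (Fin n) (Fin n) A).mulVec a.1, mulVec_mem_Lg g a.2⟩
  one_smul a := Subtype.ext (Matrix.one_mulVec a.1)
  mul_smul g h a := Subtype.ext (Matrix.mulVec_mulVec a.1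
    (g : Matrix (Fin n) (Fin n) A) (h : Matrix (Fin n) (Fin n) A)).symm

end Unimodular

/-- `GL⁰_n(A)`: the identity component of `GL_n(A)`. -/
def GL0 (A : Type*) [Ring A] [TopologicalSpace A] [IsTopologicalRing A] (n : ℕ) :
    Subgroup (Matrix (Fin n) (Fin n) A)ˣ :=
  Subgroup.connectedComponentOfOne (Matrix (Fin n) (Fin n) A)ˣ

/-- The connected stable rank: the least `n ≥ 1` such that `GL⁰_m(A)` acts transitively on
`Lg_m(A)` for all `m ≥ n`, and `⊤` if there is no such `n`. -/
noncomputable def csr (A : Type*) [Ring A] [TopologicalSpace A] [IsTopologicalRing A] : ℕ∞ :=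
  sInf {k : ℕ∞ | ∃ n : ℕ, k = (n : ℕ∞) ∧ 1 ≤ n ∧
    ∀ m : ℕ, n ≤ m → MulAction.IsPretransitive (GL0 A m) (Lg A m)}

/-- The general stable rank: the least `n ≥ 1` such that `GL_m(A)` acts transitively on
`Lg_m(A)` for all `m ≥ n`, and `⊤` if there is no such `n`. -/
noncomputable def gsr (A : Type*) [Ring A] : ℕ∞ :=
  sInf {k : ℕ∞ | ∃ n : ℕ, k = (n : ℕ∞) ∧ 1 ≤ n ∧
    ∀ m : ℕ, n ≤ m → MulAction.IsPretransitive (Matrix (Fin m) (Fin m) A)ˣ (Lg A m)}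

section Morphism

variable {A B : Type*} [NormedRing A] [NormedAlgebra ℂ A] [NormedRing B] [NormedAlgebra ℂ B]

/-- A morphism of complex Banach algebras is spectral if it preserves spectra. -/
def IsSpectral (φ : A →A[ℂ] B) : Prop :=
  ∀ a : A, spectrum ℂ (φ a) = spectrum ℂ a

theorem map_mem_Lg (φ : A →A[ℂ] B) {n : ℕ} {a : Fin n → A} (ha : a ∈ Lg A n) :
    (fun i => φ (a i)) ∈ Lg B n := by
  rw [mem_Lg_iff] at ha ⊢
  obtain ⟨c, hc⟩ := ha
  refine ⟨fun i => φ (c i), ?_⟩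
  simp only [← map_mul, ← map_sum, hc, map_one]

/-- The continuous map `Lg_n(A) → Lg_n(B)` that applies `φ` to each entry. -/
def lgMap (φ : A →A[ℂ] B) (n : ℕ) : C(Lg A n, Lg B n) where
  toFun a := ⟨fun i => φ (a.1 i), map_mem_Lg φ a.2⟩
  continuous_toFun := by
    refine Continuous.subtype_mk (continuous_pi fun i => ?_) _
    exact φ.cont.comp ((continuous_apply i).comp continuous_subtype_val)

end Morphism

/-- The map `[X] → [Y]` induced by a continuous map on sets of path components. -/
def pi0Map {X Y : Type*} [TopologicalSpace X] [TopologicalSpace Y] (f : C(X, Y)) :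
    ZerothHomotopy X → ZerothHomotopy Y :=
  Quotient.map' f fun _ _ h => Joined.map h f.continuous

end StableRank

/-! By density, coefficients witnessing that `φ(a)` is unimodular can be approximated from `A`; the
resulting sum is a unit of `B`, hence of `A` by spectrality. So `Lg_n(A)` is the preimage of the
open set `Lg_n(B)` under a linear map of dense range. Preimages of balls are convex, so such a map
is bijective on path components (`bijective_pi0Map_of_denseRange`). The `GL⁰_n`-orbits are exactly
the path components, so `csr` depends only on these. For `gsr`, an invertible matrix over `B` is
approximated by the image of a matrix over `A`, which is itself invertible: Gaussian elimination
extends spectrality to matrices (`IsSpectral.isUnit_of_isUnit_map`). -/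

namespace StableRank

open Filter Topology

/-! ### Invertible matrices over a complete normed ring -/

section MatrixUnits

variable {A : Type*} [NormedRing A] [CompleteSpace A] {n : ℕ}

theorem isOpenEmbedding_val_matrix :
    IsOpenEmbedding (Units.val : (Matrix (Fin n) (Fin n) A)ˣ → Matrix (Fin n) (Fin n) A) := by
  -- The ℓ∞ operator norm is complete and induces the entrywise topology.
  let _ : NormedRing (Matrix (Fin n) (Fin n) A) := Matrix.linftyOpNormedRing
  have : @CompleteSpace (Matrix (Fin n) (Fin n) A)
      (Matrix.linftyOpNormedRing : NormedRing (Matrix (Fin n) (Fin n)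
        A)).toMetricSpace.toPseudoMetricSpace.toUniformSpace :=
    (inferInstance : CompleteSpace (Matrix (Fin n) (Fin n) A))
  exact Units.isOpenEmbedding_val

theorem continuousAt_inverse_matrix (g : (Matrix (Fin n) (Fin n) A)ˣ) :
    ContinuousAt Ring.inverse (g : Matrix (Fin n) (Fin n) A) := by
  let _ : NormedRing (Matrix (Fin n) (Fin n) A) := Matrix.linftyOpNormedRing
  have : @CompleteSpace (Matrix (Fin n) (Fin n) A)
      (Matrix.linftyOpNormedRing : NormedRing (Matrix (Fin n) (Fin n)
        A)).toMetricSpace.toPseudoMetricSpace.toUniformSpace :=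
    (inferInstance : CompleteSpace (Matrix (Fin n) (Fin n) A))
  exact NormedRing.inverse_continuousAt g

theorem eventually_isUnit_matrix (g : (Matrix (Fin n) (Fin n) A)ˣ) :
    ∀ᶠ Y in 𝓝 (g : Matrix (Fin n) (Fin n) A), IsUnit Y :=
  isOpenEmbedding_val_matrix.isOpen_range.mem_nhds ⟨g, rfl⟩

end MatrixUnits

/-! ### Lifting invertibility and unimodularity along a dense spectral morphism -/

section Spectral

universe u

variable {A : Type u} {B : Type*} [NormedRing A] [NormedAlgebra ℂ A]
  [NormedRing B] [NormedAlgebra ℂ B] [CompleteSpace B]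
  {φ : A →A[ℂ] B} {n : ℕ}

omit [CompleteSpace B] in
theorem IsSpectral.isUnit_map_iff (hspec : IsSpectral φ) {a : A} : IsUnit (φ a) ↔ IsUnit a := by
  rw [← spectrum.zero_notMem_iff ℂ, ← spectrum.zero_notMem_iff ℂ, hspec a]

/-- Gaussian elimination: if `φ X` is close to `1`, then the relation module presented by `X`
is trivial. -/
theorem IsSpectral.eventually_relations_trivial (hspec : IsSpectral φ) (n : ℕ) :
    ∀ᶠ Y in 𝓝 (1 : Matrix (Fin n) (Fin n) B), ∀ X : Matrix (Fin n) (Fin n) A, X.map φ = Y →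
      ∀ (M : Type u) [AddCommGroup M] [Module A M] (v : Fin n → M),
        (∀ i, ∑ j, X i j • v j = 0) → v = 0 := by
  induction n with
  | zero => exact Eventually.of_forall fun _ _ _ _ _ _ _ _ => Subsingleton.elim _ _
  | succ n ih =>
    have hel : ∀ i j, ContinuousAt (fun Y : Matrix (Fin (n + 1)) (Fin (n + 1)) B => Y i j) 1 :=
      fun i j => (continuous_id.matrix_elem i j).continuousAt
    have hinv : ContinuousAt
        (fun Y : Matrix (Fin (n + 1)) (Fin (n + 1)) B => Ring.inverse (Y 0 0)) 1 := by
      refine ContinuousAt.comp (g := Ring.inverse) ?_ (hel 0 0)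
      simpa using NormedRing.inverse_continuousAt (1 : Bˣ)
    -- The Schur complement of the corner entry is continuous at `1` with value `1`, so the
    -- induction hypothesis applies to it.
    have hs : Tendsto (fun Y : Matrix (Fin (n + 1)) (Fin (n + 1)) B =>
        Matrix.of fun i j : Fin n =>
          Y i.succ j.succ - Y i.succ 0 * Ring.inverse (Y 0 0) * Y 0 j.succ) (𝓝 1) (𝓝 1) := by
      refine tendsto_pi_nhds.2 fun i => tendsto_pi_nhds.2 fun j => ?_
      have hc : ContinuousAt (fun Y : Matrix (Fin (n + 1)) (Fin (n + 1)) B =>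
          Y i.succ j.succ - Y i.succ 0 * Ring.inverse (Y 0 0) * Y 0 j.succ) 1 :=
        (hel _ _).sub (((hel _ _).mul hinv).mul (hel _ _))
      have h1 := hc.tendsto
      have e : (1 : Matrix (Fin (n + 1)) (Fin (n + 1)) B) i.succ j.succ
          - (1 : Matrix (Fin (n + 1)) (Fin (n + 1)) B) i.succ 0
            * Ring.inverse ((1 : Matrix (Fin (n + 1)) (Fin (n + 1)) B) 0 0)
            * (1 : Matrix (Fin (n + 1)) (Fin (n + 1)) B) 0 j.succ
          = (1 : Matrix (Fin n) (Fin n) B) i j := by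
        simp [Matrix.one_apply]
      rw [e] at h1
      exact h1
    have hu : ∀ᶠ Y in 𝓝 (1 : Matrix (Fin (n + 1)) (Fin (n + 1)) B), IsUnit (Y 0 0) := by
      have h1 : IsUnit ((1 : Matrix (Fin (n + 1)) (Fin (n + 1)) B) 0 0) := by simp
      exact (hel 0 0).eventually (Units.isOpen.mem_nhds h1)
    filter_upwards [hs.eventually ih, hu] with Y hY hYu X hX M _ _ v hv
    subst hX
    obtain ⟨x, hx⟩ := hspec.isUnit_map_iff.1 (by simpa using hYu : IsUnit (φ (X 0 0)))
    have hφx : Ring.inverse (φ (X 0 0)) = φ (↑x⁻¹ : A) := by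
      rw [← hx]
      exact Ring.inverse_unit (Units.map (φ : A →* B) x)
    have h0 : (X 0 0) • v 0 = - ∑ j : Fin n, X 0 j.succ • v j.succ := by
      have := hv 0
      rw [Fin.sum_univ_succ] at this
      exact eq_neg_of_add_eq_zero_left this
    have h0' : v 0 = - ((↑x⁻¹ : A) • ∑ j : Fin n, X 0 j.succ • v j.succ) := by
      rw [← smul_neg, ← h0, smul_smul, ← hx, Units.inv_mul, one_smul]
    have ht := hY (Matrix.of fun i j : Fin n =>
      X i.succ j.succ - X i.succ 0 * (↑x⁻¹ : A) * X 0 j.succ) (by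
        ext i j
        simp [hφx]) M (fun j => v j.succ) (by
        intro i
        have := hv i.succ
        rw [Fin.sum_univ_succ, h0'] at this
        simp only [Matrix.of_apply, sub_smul, Finset.sum_sub_distrib, mul_smul, ← Finset.smul_sum]
        rw [← this, smul_neg]
        abel)
    ext j
    refine Fin.cases ?_ (fun j => congrFun ht j) j
    rw [h0', Finset.sum_eq_zero, smul_zero, neg_zero, Pi.zero_apply]
    intro j _
    rw [show v j.succ = 0 from congrFun ht j, smul_zero]

theorem IsSpectral.eventually_exists_leftInverse (hspec : IsSpectral φ) (n : ℕ) :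
    ∀ᶠ Y in 𝓝 (1 : Matrix (Fin n) (Fin n) B), ∀ X : Matrix (Fin n) (Fin n) A, X.map φ = Y →
      ∃ Z, Z * X = 1 := by
  filter_upwards [hspec.eventually_relations_trivial n] with Y hY X hX
  set N : Submodule A (Fin n → A) := Submodule.span A (Set.range X.row)
  -- The basis vectors modulo the row span satisfy the relations given by `X`. Their vanishing
  -- writes each basis vector as a combination of rows, which is a left inverse.
  have h := hY X hX ((Fin n → A) ⧸ N) (fun j => N.mkQ (Pi.single j 1)) (by
    intro i
    simp only [← map_smul, ← map_sum]
    rw [Submodule.mkQ_apply, Submodule.Quotient.mk_eq_zero]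
    have : ∑ j, X i j • (Pi.single j 1 : Fin n → A) = X.row i := by
      ext k
      simp [Finset.sum_apply, Pi.single_apply]
    rw [this]
    exact Submodule.subset_span ⟨i, rfl⟩)
  have h' : ∀ j, ∃ c : Fin n → A, ∑ i, c i • X.row i = Pi.single j 1 := by
    intro j
    rw [← Submodule.mem_span_range_iff_exists_fun A, ← Submodule.Quotient.mk_eq_zero]
    exact congrFun h j
  choose c hc using h'
  refine ⟨Matrix.of c, ?_⟩
  ext j k
  have := congrFun (hc j) k
  simpa [Matrix.mul_apply, Finset.sum_apply, Matrix.one_apply, Pi.single_apply, eq_comm] using this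

/-- A left inverse `Z` of `X` maps to `Y⁻¹`, which is also near `1`. Hence `Z` has a left inverse
too, necessarily `X`. -/
theorem IsSpectral.eventually_isUnit (hspec : IsSpectral φ) (n : ℕ) :
    ∀ᶠ Y in 𝓝 (1 : Matrix (Fin n) (Fin n) B), ∀ X : Matrix (Fin n) (Fin n) A, X.map φ = Y →
      IsUnit X := by
  have hl := hspec.eventually_exists_leftInverse n
  have hi : Tendsto Ring.inverse (𝓝 (1 : Matrix (Fin n) (Fin n) B)) (𝓝 1) := by
    simpa [ContinuousAt] using continuousAt_inverse_matrix (1 : (Matrix (Fin n) (Fin n) B)ˣ)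
  filter_upwards [hl, hi.eventually hl, eventually_isUnit_matrix (1 : (Matrix (Fin n) (Fin n) B)ˣ)]
    with Y h1 h2 hu X hX
  obtain ⟨Z, hZ⟩ := h1 X hX
  have hZY : Z.map φ * Y = 1 := by
    rw [← hX]
    have := congrArg (fun W => (φ : A →+* B).mapMatrix W) hZ
    rw [map_mul, map_one] at this
    exact this
  obtain ⟨W, hW⟩ := h2 Z (by
    rw [← mul_one (Z.map φ), ← Ring.mul_inverse_cancel Y hu, ← mul_assoc, hZY, one_mul])
  have : W = X := by rw [← mul_one W, ← hZ, ← mul_assoc, hW, one_mul]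
  subst this
  exact ⟨⟨W, Z, hW, hZ⟩, rfl⟩

omit [CompleteSpace B] in
theorem denseRange_map_matrix (hdense : DenseRange φ) :
    DenseRange (fun X : Matrix (Fin n) (Fin n) A => X.map φ) :=
  DenseRange.piMap fun _ => DenseRange.piMap fun _ => hdense

/-- A dense spectral morphism detects invertibility of matrices. -/
theorem IsSpectral.isUnit_of_isUnit_map (hspec : IsSpectral φ) (hdense : DenseRange φ)
    {X : Matrix (Fin n) (Fin n) A} (hX : IsUnit (X.map φ)) : IsUnit X := by
  obtain ⟨g, hg⟩ := hX
  have hr : ∀ᶠ Z in 𝓝 (↑g⁻¹ : Matrix (Fin n) (Fin n) B),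
      ∀ W : Matrix (Fin n) (Fin n) A, W.map φ = X.map φ * Z → IsUnit W := by
    refine Tendsto.eventually (f := fun Z => X.map φ * Z) ?_ (hspec.eventually_isUnit n)
    rw [← g.mul_inv, hg]
    exact (continuous_const.mul continuous_id).tendsto _
  have hl : ∀ᶠ Z in 𝓝 (↑g⁻¹ : Matrix (Fin n) (Fin n) B),
      ∀ W : Matrix (Fin n) (Fin n) A, W.map φ = Z * X.map φ → IsUnit W := by
    refine Tendsto.eventually (f := fun Z => Z * X.map φ) ?_ (hspec.eventually_isUnit n)
    rw [← g.inv_mul, hg]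
    exact (continuous_id.mul continuous_const).tendsto _
  -- For `Z` with image near the inverse of `X.map φ`, both `X * Z` and `Z * X` map near `1`, so `X`
  -- is invertible on both sides.
  obtain ⟨Z, hZr, hZl⟩ := (denseRange_map_matrix hdense).exists_mem_open isOpen_interior
    (Filter.nonempty_of_mem (interior_mem_nhds.2 (hr.and hl))) |>.imp fun _ h => interior_subset h
  have h1 : IsUnit (X * Z) := hZr _ (map_mul (φ : A →+* B).mapMatrix X Z)
  have h2 : IsUnit (Z * X) := hZl _ (map_mul (φ : A →+* B).mapMatrix Z X)
  obtain ⟨a, ha⟩ := h1.exists_right_inv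
  obtain ⟨b, hb⟩ := h2.exists_left_inv
  exact isUnit_iff_exists.2 ⟨Z * a, by rw [← mul_assoc, ha], by
    have : Z * a = b * Z := by
      calc Z * a = b * (Z * X) * (Z * a) := by rw [hb, one_mul]
        _ = b * Z * (X * Z * a) := by simp only [mul_assoc]
        _ = b * Z := by rw [ha, mul_one]
    rw [this, mul_assoc, hb]⟩

theorem IsSpectral.map_mem_Lg_iff (hspec : IsSpectral φ) (hdense : DenseRange φ) {a : Fin n → A} :
    (fun i => φ (a i)) ∈ Lg B n ↔ a ∈ Lg A n := by
  refine ⟨fun h => ?_, map_mem_Lg φ⟩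
  obtain ⟨c, hc⟩ := mem_Lg_iff.1 h
  have hO : IsOpen {c : Fin n → B | IsUnit (∑ i, c i * φ (a i))} :=
    Units.isOpen.preimage (by fun_prop)
  obtain ⟨d, hd⟩ := (DenseRange.piMap fun _ : Fin n => hdense).exists_mem_open hO
    ⟨c, by rw [Set.mem_ofPred_eq, hc]; exact isUnit_one⟩
  have hu : IsUnit (∑ i, d i * a i) := by
    rw [← hspec.isUnit_map_iff, map_sum]
    simpa only [map_mul, Pi.map_apply, Set.mem_ofPred_eq] using hd
  obtain ⟨u, hu⟩ := hu.exists_left_inv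
  refine mem_Lg_iff.2 ⟨fun i => u * d i, ?_⟩
  rw [← hu, Finset.mul_sum]
  simp only [mul_assoc]

end Spectral

/-! ### Path components and linear maps of dense range -/

section Components

theorem eventually_joined {X : Type*} [TopologicalSpace X] [LocallyPathConnectedSpace X] (x : X) :
    ∀ᶠ y in 𝓝 x, Joined x y :=
  (IsOpen.pathComponent x).mem_nhds (mem_pathComponent_self x)

theorem zerothHomotopy_mk_eq_iff {X : Type*} [TopologicalSpace X] {x y : X} :
    (Quotient.mk'' x : ZerothHomotopy X) = Quotient.mk'' y ↔ Joined x y :=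
  Quotient.eq'

theorem _root_.IsLocallyConstant.apply_eq_of_joined {X Y : Type*} [TopologicalSpace X] {f : X → Y}
    (hf : IsLocallyConstant f) {x y : X} (h : Joined x y) : f x = f y := by
  obtain ⟨p⟩ := h
  simpa using (hf.comp_continuous p.continuous).apply_eq_of_preconnectedSpace 0 1

variable {E F : Type*} [NormedAddCommGroup E] [NormedSpace ℝ E] [NormedAddCommGroup F]
  [NormedSpace ℝ F]

/-- A linear map with dense range induces a bijection on path components between an open set and
its preimage. -/
theorem bijective_pi0Map_of_denseRange (f : E →ₗ[ℝ] F) (hf : DenseRange f) {U : Set E} {V : Set F}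
    (hV : IsOpen V) (hU : U = f ⁻¹' V) (g : C(U, V))
    (hg : ∀ u, (g u : F) = f u) : Function.Bijective (pi0Map g) := by
  have : LocallyPathConnectedSpace V := hV.locallyPathConnectedSpace
  have hgd : DenseRange g := by
    refine dense_iff_inter_open.2 fun O hO ⟨v, hv⟩ => ?_
    obtain ⟨O', hO', rfl⟩ := isOpen_induced_iff.1 hO
    obtain ⟨e, heO, heV⟩ := hf.exists_mem_open (hO'.inter hV) ⟨v, hv, v.2⟩
    refine ⟨g ⟨e, hU ▸ heV⟩, ?_, Set.mem_range_self _⟩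
    rw [Set.mem_preimage, hg]
    exact heO
  -- Points of `U` lying over a common ball in `V` are joined by a segment in the convex preimage of
  -- that ball. The component `c` gives the inverse map on components.
  have key : ∀ v : V, ∃ c : ZerothHomotopy U, ∀ᶠ w in 𝓝 v, ∀ u, g u = w → Quotient.mk'' u = c := by
    intro v
    obtain ⟨ε, hε, hεV⟩ := Metric.isOpen_iff.1 hV v v.2
    obtain ⟨u₀, hu₀⟩ := hgd.exists_mem_open
      (Metric.isOpen_ball.preimage continuous_subtype_val :
        IsOpen {w : V | (w : F) ∈ Metric.ball (v : F) ε})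
      ⟨v, Metric.mem_ball_self hε⟩
    refine ⟨Quotient.mk'' u₀, ?_⟩
    filter_upwards [(Metric.isOpen_ball.preimage continuous_subtype_val :
      IsOpen {w : V | (w : F) ∈ Metric.ball (v : F) ε}).mem_nhds (Metric.mem_ball_self hε)]
      with w hw u hu
    rw [zerothHomotopy_mk_eq_iff]
    have hconv : Convex ℝ (f ⁻¹' Metric.ball (v : F) ε) := (convex_ball _ _).linear_preimage f
    have h1 : (u : E) ∈ f ⁻¹' Metric.ball (v : F) ε := by
      rw [Set.mem_preimage, ← hg, hu]; exact hw
    have h2 : (u₀ : E) ∈ f ⁻¹' Metric.ball (v : F) ε := by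
      rw [Set.mem_preimage, ← hg]; exact hu₀
    have hj := (hconv.isPathConnected ⟨_, h1⟩).joinedIn _ h1 _ h2
    exact (hj.mono (hU ▸ Set.preimage_mono hεV)).joined_subtype
  choose r hr using key
  have hrl : IsLocallyConstant r := by
    rw [IsLocallyConstant.iff_eventually_eq]
    intro v
    -- By density some `g u` lies close to `w`, and the class of `u` equals both `r w` and `r v`.
    filter_upwards [(hr v).eventually_nhds] with w hw
    obtain ⟨O, hO, hOo, hwO⟩ := eventually_nhds_iff.1 (hw.and (hr w))
    obtain ⟨u, hu⟩ := hgd.exists_mem_open hOo ⟨w, hwO⟩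
    rw [← (hO _ hu).1 u rfl, (hO _ hu).2 u rfl]
  have hrg : ∀ u, r (g u) = Quotient.mk'' u := fun u => ((hr (g u)).self_of_nhds u rfl).symm
  refine ⟨?_, ?_⟩
  · intro x y
    induction x using Quotient.inductionOn'
    induction y using Quotient.inductionOn'
    intro h
    rw [← hrg, ← hrg]
    exact hrl.apply_eq_of_joined (zerothHomotopy_mk_eq_iff.1 h)
  · intro y
    induction y using Quotient.inductionOn' with | _ v
    obtain ⟨u, hu⟩ := hgd.exists_mem_open (IsOpen.pathComponent v) ⟨v, mem_pathComponent_self v⟩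
    exact ⟨Quotient.mk'' u, zerothHomotopy_mk_eq_iff.2 (Joined.symm hu)⟩

end Components

/-! ### Orbits of the identity component on unimodular tuples -/

section Banach

variable {A : Type*} [NormedRing A] [CompleteSpace A] {n : ℕ}

theorem isOpen_Lg : IsOpen (Lg A n) := by
  refine isOpen_iff_mem_nhds.2 fun a ha => ?_
  obtain ⟨c, hc⟩ := mem_Lg_iff.1 ha
  have hO : IsOpen {b : Fin n → A | IsUnit (∑ i, c i * b i)} :=
    Units.isOpen.preimage (by fun_prop)
  filter_upwards [hO.mem_nhds (by rw [Set.mem_ofPred_eq, hc]; exact isUnit_one)] with b hb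
  obtain ⟨u, hu⟩ := hb.exists_left_inv
  refine mem_Lg_iff.2 ⟨fun i => u * c i, ?_⟩
  rw [← hu, Finset.mul_sum]
  simp only [mul_assoc]

omit [CompleteSpace A] in
theorem coe_smul_Lg (g : (Matrix (Fin n) (Fin n) A)ˣ) (a : Lg A n) :
    ((g • a : Lg A n) : Fin n → A) = (g : Matrix (Fin n) (Fin n) A).mulVec a := rfl

variable [NormedSpace ℝ A]

theorem locallyPathConnectedSpace_Lg : LocallyPathConnectedSpace (Lg A n) :=
  isOpen_Lg.locallyPathConnectedSpace

/-- The invertible matrices form an open, hence locally path connected, set, so their identity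
component is open. -/
theorem eventually_mem_GL0 :
    ∀ᶠ X in 𝓝 (1 : Matrix (Fin n) (Fin n) A),
      ∃ g ∈ GL0 A n, (g : Matrix (Fin n) (Fin n) A) = X := by
  have : LocallyPathConnectedSpace (Matrix (Fin n) (Fin n) A) :=
    inferInstanceAs (LocallyPathConnectedSpace (Fin n → Fin n → A))
  have hL : LocallyPathConnectedSpace (Matrix (Fin n) (Fin n) A)ˣ :=
    isOpenEmbedding_val_matrix.locallyPathConnectedSpace
  have h1 : connectedComponent (1 : (Matrix (Fin n) (Fin n) A)ˣ) ∈ 𝓝 1 := by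
    rw [← pathComponent_eq_connectedComponent]
    exact (IsOpen.pathComponent _).mem_nhds (mem_pathComponent_self _)
  have := isOpenEmbedding_val_matrix.isOpenMap.image_mem_nhds h1
  exact this

/-- Nearby unimodular tuples are in the same `GL⁰`-orbit. -/
theorem eventually_exists_GL0_smul_eq (a : Lg A n) : ∀ᶠ b in 𝓝 a, ∃ g ∈ GL0 A n, g • a = b := by
  obtain ⟨c, hc⟩ := mem_Lg_iff.1 a.2
  -- Since `c ⬝ᵥ a = 1`, the matrix `1 + (b - a)c` sends `a` to `b`.
  have ht : Tendsto (fun b : Lg A n => 1 + Matrix.vecMulVec (b.1 - a.1) c) (𝓝 a)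
      (𝓝 (1 : Matrix (Fin n) (Fin n) A)) := by
    have hcont : Continuous (fun b : Lg A n => 1 + Matrix.vecMulVec (b.1 - a.1) c) :=
      continuous_const.add
        ((continuous_subtype_val.sub continuous_const).matrix_vecMulVec continuous_const)
    simpa using hcont.tendsto a
  filter_upwards [ht.eventually eventually_mem_GL0] with b hb
  obtain ⟨g, hg, hgb⟩ := hb
  refine ⟨g, hg, Subtype.ext ?_⟩
  rw [coe_smul_Lg, hgb, Matrix.add_mulVec, Matrix.one_mulVec, Matrix.vecMulVec_mulVec]
  ext i
  have : c ⬝ᵥ a.1 = 1 := hc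
  simp [this]

/-- The `GL⁰`-orbits on the unimodular tuples are the path components. -/
theorem joined_iff_exists_GL0_smul_eq {a b : Lg A n} : Joined a b ↔ ∃ g ∈ GL0 A n, g • a = b := by
  have : LocallyPathConnectedSpace (Lg A n) := locallyPathConnectedSpace_Lg
  constructor
  · intro h
    -- Orbits are open, so a path cannot leave one.
    have hl : IsLocallyConstant (fun x : Lg A n =>
        (Quotient.mk'' x : MulAction.orbitRel.Quotient (GL0 A n) (Lg A n))) := by
      rw [IsLocallyConstant.iff_eventually_eq]
      intro x
      filter_upwards [eventually_exists_GL0_smul_eq x] with y hy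
      obtain ⟨g, hg, rfl⟩ := hy
      exact Quotient.sound' ⟨⟨g, hg⟩, rfl⟩
    have := Quotient.exact' (hl.apply_eq_of_joined h.symm)
    obtain ⟨g, hg⟩ := this
    exact ⟨g.1, g.2, hg⟩
  · rintro ⟨g, hg, rfl⟩
    have hc : Continuous fun g : (Matrix (Fin n) (Fin n) A)ˣ => g • a :=
      Continuous.subtype_mk (Units.continuous_val.matrix_mulVec continuous_const) _
    have hp : IsPreconnected ((fun g : (Matrix (Fin n) (Fin n) A)ˣ => g • a) ''
        connectedComponent 1) := isPreconnected_connectedComponent.image _ hc.continuousOn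
    have h := hp.subset_connectedComponent ⟨1, mem_connectedComponent, one_smul _ a⟩
      ⟨g, hg, rfl⟩
    rw [← pathComponent_eq_connectedComponent] at h
    exact h

theorem isPretransitive_GL0_iff :
    MulAction.IsPretransitive (GL0 A n) (Lg A n) ↔ Subsingleton (ZerothHomotopy (Lg A n)) := by
  constructor
  · refine fun h => ⟨fun x y => ?_⟩
    induction x using Quotient.inductionOn'
    induction y using Quotient.inductionOn'
    obtain ⟨g, hg⟩ := h.exists_smul_eq _ _
    exact zerothHomotopy_mk_eq_iff.2 (joined_iff_exists_GL0_smul_eq.2 ⟨g.1, g.2, hg⟩)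
  · refine fun h => ⟨fun a b => ?_⟩
    obtain ⟨g, hg, e⟩ := joined_iff_exists_GL0_smul_eq.1
      (zerothHomotopy_mk_eq_iff.1 (h.elim (Quotient.mk'' a) (Quotient.mk'' b)))
    exact ⟨⟨g, hg⟩, e⟩

end Banach

/-! ### Comparison of the stable ranks -/

section Main

variable {A B : Type*} [NormedRing A] [NormedAlgebra ℂ A] [CompleteSpace A]
  [NormedRing B] [NormedAlgebra ℂ B] [CompleteSpace B] {φ : A →A[ℂ] B}

omit [CompleteSpace A] in
theorem bijective_pi0Map_lgMap (hdense : DenseRange φ) (hspec : IsSpectral φ) (n : ℕ) :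
    Function.Bijective (pi0Map (lgMap φ n)) := by
  let f : (Fin n → A) →ₗ[ℝ] (Fin n → B) :=
    ((φ : A →ₐ[ℂ] B).toLinearMap.restrictScalars ℝ).compLeft (Fin n)
  refine bijective_pi0Map_of_denseRange f (DenseRange.piMap fun _ => hdense) isOpen_Lg ?_ _ fun _ => rfl
  ext a
  exact (hspec.map_mem_Lg_iff hdense).symm

theorem isPretransitive_GL_iff (hdense : DenseRange φ) (hspec : IsSpectral φ) (n : ℕ) :
    MulAction.IsPretransitive (Matrix (Fin n) (Fin n) A)ˣ (Lg A n) ↔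
      MulAction.IsPretransitive (Matrix (Fin n) (Fin n) B)ˣ (Lg B n) := by
  have hbij := bijective_pi0Map_lgMap hdense hspec n
  have : LocallyPathConnectedSpace (Lg B n) := locallyPathConnectedSpace_Lg
  constructor
  · refine fun h => ⟨fun b b' => ?_⟩
    -- Surjectivity on components puts every `b` in the orbit of a tuple coming from `A`.
    have hlift : ∀ b : Lg B n, ∃ a : Lg A n, ∃ g : (Matrix (Fin n) (Fin n) B)ˣ,
        g • lgMap φ n a = b := by
      intro b
      obtain ⟨x, hx⟩ := hbij.2 (Quotient.mk'' b)
      induction x using Quotient.inductionOn' with | _ a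
      obtain ⟨g, -, hg⟩ := joined_iff_exists_GL0_smul_eq.1 (zerothHomotopy_mk_eq_iff.1 hx)
      exact ⟨a, g, hg⟩
    obtain ⟨a, g, rfl⟩ := hlift b
    obtain ⟨a', g', rfl⟩ := hlift b'
    obtain ⟨k, rfl⟩ := h.exists_smul_eq a a'
    let ψ : Matrix (Fin n) (Fin n) A →* Matrix (Fin n) (Fin n) B :=
      ((φ : A →+* B).mapMatrix : Matrix (Fin n) (Fin n) A →+* Matrix (Fin n) (Fin n) B)
    have hk : lgMap φ n (k • a) = Units.map ψ k • lgMap φ n a := by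
      refine Subtype.ext (funext fun i => ?_)
      exact RingHom.map_mulVec (φ : A →+* B) k.1 a.1 i
    refine ⟨g' * Units.map ψ k * g⁻¹, ?_⟩
    rw [mul_smul, inv_smul_smul, mul_smul, hk]
  · refine fun h => ⟨fun a a' => ?_⟩
    obtain ⟨T, hT⟩ := h.exists_smul_eq (lgMap φ n a) (lgMap φ n a')
    -- `T` need not lift, but moving it slightly keeps the image tuple in the same component;
    -- injectivity on components then carries the conclusion back to `A`.
    have hj : ∀ᶠ S in 𝓝 T, Joined (S • lgMap φ n a) (lgMap φ n a') := by
      have hc : Continuous fun g : (Matrix (Fin n) (Fin n) B)ˣ => g • lgMap φ n a :=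
        Continuous.subtype_mk (Units.continuous_val.matrix_mulVec continuous_const) _
      have := hc.tendsto T
      rw [hT] at this
      exact (this.eventually (eventually_joined _)).mono fun _ h => h.symm
    have hO := isOpenEmbedding_val_matrix.isOpenMap.image_mem_nhds hj
    obtain ⟨S, hS⟩ := (denseRange_map_matrix hdense).exists_mem_open isOpen_interior
      (Filter.nonempty_of_mem (interior_mem_nhds.2 hO))
    obtain ⟨S', hS', e⟩ := interior_subset hS
    obtain ⟨k, rfl⟩ := hspec.isUnit_of_isUnit_map hdense ⟨S', e⟩
    have hk : lgMap φ n (k • a) = S' • lgMap φ n a := by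
      refine Subtype.ext (funext fun i => ?_)
      rw [coe_smul_Lg, e]
      exact RingHom.map_mulVec (φ : A →+* B) k.1 a.1 i
    have h1 : Joined (k • a) a' := by
      rw [← zerothHomotopy_mk_eq_iff]
      refine hbij.1 (zerothHomotopy_mk_eq_iff.2 ?_)
      rw [hk]
      exact hS'
    obtain ⟨g, -, hg⟩ := joined_iff_exists_GL0_smul_eq.1 h1
    exact ⟨g * k, by rw [mul_smul, hg]⟩

theorem isPretransitive_GL0_iff_map (hdense : DenseRange φ) (hspec : IsSpectral φ) (n : ℕ) :
    MulAction.IsPretransitive (GL0 A n) (Lg A n) ↔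
      MulAction.IsPretransitive (GL0 B n) (Lg B n) := by
  rw [isPretransitive_GL0_iff, isPretransitive_GL0_iff]
  exact (Equiv.ofBijective _ (bijective_pi0Map_lgMap hdense hspec n)).subsingleton_congr

end Main

end StableRank

theorem mainTheorem1 {A B : Type*}
    [NormedRing A] [NormedAlgebra ℂ A] [CompleteSpace A]
    [NormedRing B] [NormedAlgebra ℂ B] [CompleteSpace B]
    (φ : A →A[ℂ] B) (hdense : DenseRange φ) (hspec : StableRank.IsSpectral φ) :
    StableRank.csr A = StableRank.csr B ∧
    StableRank.gsr A = StableRank.gsr B ∧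
    ∀ n : ℕ, 1 ≤ n →
      Function.Bijective (StableRank.pi0Map (StableRank.lgMap φ n)) := by
  refine ⟨?_, ?_, fun n _ => StableRank.bijective_pi0Map_lgMap hdense hspec n⟩
  · simp only [StableRank.csr, StableRank.isPretransitive_GL0_iff_map hdense hspec]
  · simp only [StableRank.gsr, StableRank.isPretransitive_GL_iff hdense hspec]
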